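/- Let $d\ge 1$ and $\hat F^0:=[0,1]^{d-1}$, and let $\phi:\hat F^0\to\mathbb{R}$ be Lipschitz continuous. Put $$\hat K:=\{x\in\mathbb{R}^d:\ 0\le x_i\le 1\ (i=1,\dots,d-1),\ 0\le x_d\le \phi(x_1,\dots,x_{d-1})\},$$ and suppose that $\hat K$ is a reference generalized prism, that is: (1) $[0,1]^d\subset\hat K$; and (2) the flat base is star-shaped with respect to the curved base, i.e. for every $a\in\hat F^0\times\{0\}$ and every $b$ in the graph $\hat F:=\{x\in\mathbb{R}^d: (x_1,\dots,x_{d-1})\in\hat F^0,\ x_d=\phi(x_1,\dots,x_{d-1})\}$, the closed segment from $a$ to $b$ is contained in $\hat K$. Let $\hat r:=\lfloor\max_{\hat F^0}\phi\rfloor+1$. Then for every integer $p\ge 0$ and every real polynomial $v$ in $d$ variables of total degree at most $p$, $$\|\nabla v\|_{L_2(\hat K)}^2\le C\,p^4\,\|v\|_{L_2(\hat K)}^2,\qquad C:=64(d-1)\hat r(\hat r+1)(2\hat r+1)+12d,$$ where both $L_2(\hat K)$ norms are finite and $\|\nabla v\|_{L_2(\hat K)}$ is taken with the Euclidean norm of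 $\nabla v$. -/

import Mathlib

open MeasureTheory

namespace GenPrism

/-- The flat base `[0,1]^n`, as a subset of `ℝ^n` (here `n = d - 1`). -/
def unitCube (n : ℕ) : Set (EuclideanSpace ℝ (Fin n)) :=
  {x | ∀ i, 0 ≤ x i ∧ x i ≤ 1}

/-- The first `n` coordinates of a point of `ℝ^(n+1)`. -/
def baseCoords {n : ℕ} (x : EuclideanSpace ℝ (Fin (n + 1))) : EuclideanSpace ℝ (Fin n) :=
  WithLp.toLp 2 fun i => x i.castSucc

/-- The set of points of `ℝ^(n+1)` lying above `[0,1]^n × {0}` and below the graph of `φ`. -/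
def prism {n : ℕ} (φ : EuclideanSpace ℝ (Fin n) → ℝ) : Set (EuclideanSpace ℝ (Fin (n + 1))) :=
  {x | baseCoords x ∈ unitCube n ∧ 0 ≤ x (Fin.last n) ∧ x (Fin.last n) ≤ φ (baseCoords x)}

/-- The flat base `[0,1]^n × {0}` inside `ℝ^(n+1)`. -/
def flatBase (n : ℕ) : Set (EuclideanSpace ℝ (Fin (n + 1))) :=
  {x | baseCoords x ∈ unitCube n ∧ x (Fin.last n) = 0}

/-- The curved base, i.e. the graph of `φ` over `[0,1]^n`. -/
def curvedBase {n : ℕ} (φ : EuclideanSpace ℝ (Fin n) → ℝ) :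
    Set (EuclideanSpace ℝ (Fin (n + 1))) :=
  {x | baseCoords x ∈ unitCube n ∧ x (Fin.last n) = φ (baseCoords x)}

/-- `φ` defines a reference generalized prism in `ℝ^(n+1)`. Only the values of `φ` on `[0,1]^n`
matter. Star-shapedness of the flat base with respect to the curved base means that each segment
joining a point of the flat base to a point of the curved base lies in the prism. -/
structure IsReferenceGeneralizedPrism {n : ℕ} (φ : EuclideanSpace ℝ (Fin n) → ℝ) : Prop where
  lipschitz : ∃ L : NNReal, LipschitzOnWith L φ (unitCube n)
  cube_subset : unitCube (n + 1) ⊆ prism φ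
  starShaped : ∀ a ∈ flatBase n, ∀ b ∈ curvedBase φ, segment ℝ a b ⊆ prism φ

/-- `r̂ = ⌊max φ⌋ + 1`, the maximum being over `[0,1]^n`. -/
noncomputable def rHat {n : ℕ} (φ : EuclideanSpace ℝ (Fin n) → ℝ) : ℤ :=
  ⌊sSup (φ '' unitCube n)⌋ + 1

/-- The constant `64 (d-1) r (r+1) (2r+1) + 12 d`. -/
def invConst (d : ℕ) (r : ℝ) : ℝ :=
  64 * ((d : ℝ) - 1) * r * (r + 1) * (2 * r + 1) + 12 * (d : ℝ)

/-- The function on `ℝ^d` given by a polynomial in `d` variables. -/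
noncomputable def polyFun {d : ℕ} (v : MvPolynomial (Fin d) ℝ) : EuclideanSpace ℝ (Fin d) → ℝ :=
  fun x => MvPolynomial.eval (fun i => x i) v

end GenPrism

/-! On an interval of length at least 1, a polynomial of degree at most `p` satisfies `∫ (q')² ≤ 12
p⁴ ∫ q²` (`integral_derivative_sq_le`). By Tonelli this passes to the derivative along `e` on any
compact set that each line parallel to `e` meets, if at all, in an interval of parameter length at
least 1 (`setIntegral_dirDeriv_sq_le`).

The vertical direction is admissible on the whole prism. A horizontal direction `e_i` need not be:
above height 1 a horizontal slice can be short or disconnected. There `∂_i` is recovered from the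
vertical derivative and the derivative along `e_d - s e_i`. Star-shapedness makes slanted lines
admissible: descending from a point of the prism to a foot on the flat base stays inside
(`descend`), and a slanted line that also reaches height 1 inside the unit cube has parameter length
at least 1. With `s = ±1/(2 r̂)`, the two slanted parts and the unit cube cover the prism
(`prism_subset_union`). Each horizontal derivative then costs a factor `1 + 32 r̂²`, and summation
over the coordinates gives a bound below the stated constant.

The one-variable estimate is proved by induction on the degree, splitting off at each step a
multiple of the monic Legendre polynomial, whose derivative has an exactly computable norm. -/

namespace GenPrism

/-! ### The inverse estimate in one variable, by Legendre polynomials on `[0,1]`. -/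

section OneVariable

open Polynomial

/-- Integration of a polynomial over `[0,1]`, as a linear form. -/
noncomputable def unitIntegral : ℝ[X] →ₗ[ℝ] ℝ where
  toFun q := ∫ x in (0 : ℝ)..1, q.eval x
  map_add' q w := by
    simp only [eval_add]
    exact intervalIntegral.integral_add (q.continuous.intervalIntegrable _ _)
      (w.continuous.intervalIntegrable _ _)
  map_smul' c q := by simp [eval_smul]

lemma unitIntegral_apply (q : ℝ[X]) : unitIntegral q = ∫ x in (0 : ℝ)..1, q.eval x := rfl

lemma unitIntegral_derivative (q : ℝ[X]) :
    unitIntegral (derivative q) = q.eval 1 - q.eval 0 :=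
  intervalIntegral.integral_eq_sub_of_hasDerivAt (fun x _ => q.hasDerivAt x)
    ((derivative q).continuous.intervalIntegrable _ _)

lemma unitIntegral_derivative_mul (q w : ℝ[X]) :
    unitIntegral (derivative q * w) =
      q.eval 1 * w.eval 1 - q.eval 0 * w.eval 0 - unitIntegral (q * derivative w) := by
  have h := unitIntegral_derivative (q * w)
  rw [derivative_mul, map_add, eval_mul, eval_mul] at h
  linarith

lemma unitIntegral_C_mul (c : ℝ) (q : ℝ[X]) : unitIntegral (C c * q) = c * unitIntegral q := by
  rw [← smul_eq_C_mul, map_smul, smul_eq_mul]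

lemma unitIntegral_mul_self_nonneg (q : ℝ[X]) : 0 ≤ unitIntegral (q * q) :=
  intervalIntegral.integral_nonneg zero_le_one fun x _ => by
    rw [eval_mul]; exact mul_self_nonneg _

lemma eq_zero_of_unitIntegral_mul_self (q : ℝ[X]) (h : unitIntegral (q * q) = 0) : q = 0 := by
  by_contra hq
  refine (ne_of_gt ?_) h
  obtain ⟨x, hx, hxq⟩ : ∃ x ∈ Set.Icc (0 : ℝ) 1, q.eval x ≠ 0 := by
    by_contra! hall
    exact hq (eq_zero_of_infinite_isRoot q
      ((Set.Icc_infinite zero_lt_one).mono fun x hx => hall x hx))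
  refine intervalIntegral.integral_pos zero_lt_one (q * q).continuous.continuousOn
    (fun x _ => by rw [eval_mul]; exact mul_self_nonneg _) ⟨x, hx, ?_⟩
  rw [eval_mul]
  exact mul_self_pos.2 hxq

/-- `L` is the monic polynomial of degree `p` orthogonal in `L²(0,1)` to all lower degrees. -/
structure IsLegendre (p : ℕ) (L : ℝ[X]) : Prop where
  coeff_self : L.coeff p = 1
  coeff_of_gt : ∀ m, p < m → L.coeff m = 0
  orthogonal : ∀ w : ℝ[X], w.degree < p → unitIntegral (L * w) = 0

/-- The `L²` form is positive definite on polynomials of degree below `p`, so by finite dimension it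
represents every linear form there. Representing integration against `X ^ p` gives the projection
`u` of `X ^ p`, and `X ^ p - u` is the required polynomial. -/
lemma exists_isLegendre (p : ℕ) : ∃ L, IsLegendre p L := by
  let V := degreeLT ℝ p
  let B : V →ₗ[ℝ] Module.Dual ℝ V :=
    LinearMap.mk₂ ℝ (fun q w : V => unitIntegral ((q : ℝ[X]) * (w : ℝ[X])))
      (fun a b c => by simp [add_mul]) (fun c a b => by simp)
      (fun a b c => by simp [mul_add]) (fun c a b => by simp)
  have : Module.Finite ℝ V := Module.Finite.equiv (degreeLTEquiv ℝ p).symm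
  have hinj : Function.Injective B := by
    rw [injective_iff_map_eq_zero]
    intro q hq
    have : unitIntegral ((q : ℝ[X]) * (q : ℝ[X])) = 0 := congrArg (fun g => g q) hq
    exact Subtype.ext (eq_zero_of_unitIntegral_mul_self _ this)
  have hsurj : Function.Surjective B :=
    (LinearMap.injective_iff_surjective_of_finrank_eq_finrank
      (Subspace.dual_finrank_eq).symm).1 hinj
  obtain ⟨u, hu⟩ := hsurj
    ((unitIntegral.comp (LinearMap.mulLeft ℝ ((X : ℝ[X]) ^ p))).comp V.subtype)
  have hdeg := mem_degreeLT.1 u.2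
  have hcoeff := (degree_lt_iff_coeff_zero _ _).1 hdeg
  refine ⟨X ^ p - (u : ℝ[X]), ?_, ?_, ?_⟩
  · rw [coeff_sub, hcoeff p le_rfl]; simp
  · intro m hm
    rw [coeff_sub, hcoeff m hm.le, coeff_X_pow, if_neg (by omega)]; simp
  · intro w hw
    have : unitIntegral ((u : ℝ[X]) * w) = unitIntegral (X ^ p * w) :=
      congrArg (fun g => g ⟨w, mem_degreeLT.2 hw⟩) hu
    rw [sub_mul, map_sub, this, sub_self]

lemma coeff_X_mul_derivative (q : ℝ[X]) (m : ℕ) :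
    (X * derivative q).coeff m = m * q.coeff m := by
  cases m with
  | zero => simp
  | succ k => rw [coeff_X_mul, coeff_derivative]; push_cast; ring

/-- The Legendre operator does not raise degrees and acts on the top coefficient, in degree `m`, by
`-m (m + 1)`. -/
lemma coeff_derivative_weight_mul_derivative (q : ℝ[X]) (m : ℕ) :
    (derivative (X * (1 - X) * derivative q)).coeff m =
      (m + 1) * ((m + 1) * q.coeff (m + 1) - m * q.coeff m) := by
  have h : X * (1 - X) * derivative q = X * derivative q - X * (X * derivative q) := by ring
  rw [coeff_derivative, h, coeff_sub, coeff_X_mul_derivative, coeff_X_mul, coeff_X_mul_derivative]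
  push_cast
  ring

/-- The residual `N` has degree below `p`, because the leading terms cancel. The operator is
symmetric, since its weight vanishes at 0 and 1, so `∫ N²` is an integral of `L` against polynomials
of degree below `p`, hence zero. -/
lemma IsLegendre.differential_equation {p : ℕ} {L : ℝ[X]} (h : IsLegendre p L) :
    derivative (X * (1 - X) * derivative L) + C ((p : ℝ) * (p + 1)) * L = 0 := by
  set N := derivative (X * (1 - X) * derivative L) + C ((p : ℝ) * (p + 1)) * L with hN
  have hself : ∀ w : ℝ[X], unitIntegral (derivative (X * (1 - X) * derivative L) * w) =
      unitIntegral (L * derivative (X * (1 - X) * derivative w)) := by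
    intro w
    have h1 := unitIntegral_derivative_mul (X * (1 - X) * derivative L) w
    have h2 := unitIntegral_derivative_mul (X * (1 - X) * derivative w) L
    simp only [eval_mul, eval_sub, eval_X, eval_one] at h1 h2
    have e : X * (1 - X) * derivative L * derivative w
        = X * (1 - X) * derivative w * derivative L := by ring
    rw [mul_comm L, h1, h2, e]
    ring
  have hNdeg : N.degree < p := by
    rw [degree_lt_iff_coeff_zero]
    intro m hm
    rw [hN, coeff_add, coeff_derivative_weight_mul_derivative, coeff_C_mul,
      h.coeff_of_gt (m + 1) (by omega)]
    rcases hm.eq_or_lt with rfl | hm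
    · ring
    · rw [h.coeff_of_gt m hm]; ring
  have hNdeg' : (derivative (X * (1 - X) * derivative N)).degree < p := by
    rw [degree_lt_iff_coeff_zero] at hNdeg ⊢
    intro m hm
    rw [coeff_derivative_weight_mul_derivative, hNdeg m hm, hNdeg (m + 1) (by omega)]
    ring
  apply eq_zero_of_unitIntegral_mul_self
  nth_rewrite 1 [hN]
  rw [add_mul, map_add, hself, h.orthogonal _ hNdeg', mul_assoc, unitIntegral_C_mul,
    h.orthogonal _ hNdeg]
  ring

/-- The polynomial `(2X - 1) L' - 2p L` has degree below `p`, so it is orthogonal to `L`.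
Integrating the derivative of `(2X - 1) L²` then yields the boundary values. -/
lemma IsLegendre.sum_eval_sq {p : ℕ} {L : ℝ[X]} (h : IsLegendre p L) :
    L.eval 1 ^ 2 + L.eval 0 ^ 2 = (4 * p + 2) * unitIntegral (L * L) := by
  have hdeg : ((2 * X - 1 : ℝ[X]) * derivative L - C (2 * (p : ℝ)) * L).degree <
      (p : WithBot ℕ) := by
    rw [degree_lt_iff_coeff_zero]
    intro m hm
    have e : (2 * X - 1) * derivative L = C (2 : ℝ) * (X * derivative L) - derivative L := by
      simp only [map_ofNat]; ring
    rw [e, coeff_sub, coeff_sub, coeff_C_mul, coeff_C_mul, coeff_X_mul_derivative,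
      coeff_derivative, h.coeff_of_gt (m + 1) (by omega)]
    rcases hm.eq_or_lt with rfl | hm
    · ring
    · rw [h.coeff_of_gt m hm]; ring
  have h1 := h.orthogonal _ hdeg
  have h2 := unitIntegral_derivative ((2 * X - 1) * (L * L))
  have e1 : L * ((2 * X - 1) * derivative L - C (2 * (p : ℝ)) * L)
      = L * (2 * X - 1) * derivative L - C (2 * (p : ℝ)) * (L * L) := by ring
  have e2 : derivative ((2 * X - 1) * (L * L))
      = C (2 : ℝ) * (L * L) + C (2 : ℝ) * (L * (2 * X - 1) * derivative L) := by
    simp only [derivative_mul, derivative_sub, derivative_X, derivative_one, derivative_ofNat,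
      map_ofNat]
    ring
  rw [e1, map_sub, unitIntegral_C_mul] at h1
  rw [e2, map_add, unitIntegral_C_mul, unitIntegral_C_mul] at h2
  simp only [eval_mul, eval_sub, eval_X, eval_one, eval_ofNat] at h2
  linear_combination (-1 : ℝ) * h2 + 2 * h1

/-- Integration by parts leaves only boundary terms, since `L''` is orthogonal to `L`. At the
endpoints the differential equation degenerates to `L'(1) = p(p+1) L(1)` and `L'(0) = -p(p+1) L(0)`.
-/
lemma IsLegendre.unitIntegral_derivative_sq {p : ℕ} {L : ℝ[X]} (h : IsLegendre p L) :
    unitIntegral (derivative L * derivative L) =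
      p * (p + 1) * (4 * p + 2) * unitIntegral (L * L) := by
  have hdeg : (derivative (derivative L)).degree < p := by
    rw [degree_lt_iff_coeff_zero]
    intro m hm
    rw [coeff_derivative, coeff_derivative, h.coeff_of_gt _ (by omega)]
    ring
  have hode (x : ℝ) := congrArg (eval x) h.differential_equation
  have h1 := hode 1
  have h0 := hode 0
  simp only [derivative_mul, derivative_X, derivative_sub, derivative_one, eval_add, eval_mul,
    eval_sub, eval_X, eval_one, eval_C, eval_zero] at h1 h0
  have h2 := unitIntegral_derivative_mul L (derivative L)
  rw [h.orthogonal _ hdeg] at h2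
  rw [h2]
  linear_combination (p : ℝ) * (p + 1) * h.sum_eval_sq - eval 1 L * h1 - eval 0 L * h0

/-- The inverse estimate on `(0,1)`, with the constant obtained from the Legendre expansion. -/
lemma unitIntegral_derivative_sq_le (p : ℕ) :
    ∀ q : ℝ[X], q.natDegree ≤ p → unitIntegral (derivative q * derivative q) ≤
      p * (p + 1) ^ 2 * (p + 2) * unitIntegral (q * q) := by
  induction p with
  | zero =>
    intro q hq
    rw [derivative_of_natDegree_zero (Nat.le_zero.1 hq)]
    simp
  | succ p ih =>
    intro q hq
    obtain ⟨L, hL⟩ := exists_isLegendre (p + 1)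
    set a := q.coeff (p + 1)
    set w := q - C a * L with hw
    have hwdeg : w.degree < ((p + 1 : ℕ) : WithBot ℕ) := by
      rw [degree_lt_iff_coeff_zero]
      intro m hm
      rw [hw, coeff_sub, coeff_C_mul]
      rcases hm.eq_or_lt with rfl | hm
      · rw [hL.coeff_self]; ring
      · rw [hL.coeff_of_gt m hm, coeff_eq_zero_of_natDegree_lt (by omega)]; ring
    have hwnat : w.natDegree ≤ p := by
      rw [natDegree_le_iff_degree_le, ← Order.lt_succ_iff]
      exact hwdeg
    have hq : q = C a * L + w := by rw [hw]; ring
    have hLw := hL.orthogonal w hwdeg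
    have hLL := hL.unitIntegral_derivative_sq
    have hww := ih w hwnat
    have e1 : unitIntegral (q * q) =
        a ^ 2 * unitIntegral (L * L) + unitIntegral (w * w) := by
      have : q * q = C (a ^ 2) * (L * L) + C (2 * a) * (L * w) + w * w := by
        rw [hq]; simp only [C_mul, C_pow, map_ofNat]; ring
      rw [this, map_add, map_add, unitIntegral_C_mul, unitIntegral_C_mul, hLw]
      ring
    have hexp : ∀ s t : ℝ, unitIntegral ((C s * derivative L + C t * derivative w) *
        (C s * derivative L + C t * derivative w)) =
        s ^ 2 * unitIntegral (derivative L * derivative L) +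
        2 * s * t * unitIntegral (derivative L * derivative w) +
        t ^ 2 * unitIntegral (derivative w * derivative w) := by
      intro s t
      have : (C s * derivative L + C t * derivative w) * (C s * derivative L + C t * derivative w)
          = C (s ^ 2) * (derivative L * derivative L) +
          C (2 * s * t) * (derivative L * derivative w) +
          C (t ^ 2) * (derivative w * derivative w) := by
        simp only [C_mul, C_pow, map_ofNat]; ring
      rw [this, map_add, map_add, unitIntegral_C_mul, unitIntegral_C_mul, unitIntegral_C_mul]
    have e2 := hexp a 1
    have hdq : derivative q = C a * derivative L + C 1 * derivative w := by
      rw [hq]; simp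
    rw [← hdq] at e2
    have hLLn := unitIntegral_mul_self_nonneg L
    have hwwn := unitIntegral_mul_self_nonneg w
    set x := unitIntegral (derivative L * derivative w)
    set α := a ^ 2 * unitIntegral (L * L) with hα
    have hαn : 0 ≤ α := by positivity
    push_cast at hLL ⊢
    set c₁ : ℝ := (p + 1) * (p + 1 + 1) * (4 * (p + 1) + 2) with hc₁
    set c₂ : ℝ := p * (p + 1) ^ 2 * (p + 2) with hc₂
    have hc₁pos : 0 < c₁ := by positivity
    -- Weighted Young inequality: expand `∫ (c₂ a L' - c₁ w')² ≥ 0` and divide by `c₁ c₂`. For `p =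
    -- 0` this fails as `c₂ = 0`, but then `w' = 0`. These weights make the constants of `L` and `w`
    -- add up to `c₁ + c₂`.
    have hcross : 2 * a * x ≤ c₂ * α + c₁ * unitIntegral (w * w) := by
      rcases Nat.eq_zero_or_pos p with rfl | hp
      · have : x = 0 := by
          simp only [x, derivative_of_natDegree_zero (Nat.le_zero.1 hwnat), mul_zero, map_zero]
        rw [this, mul_zero]
        positivity
      · have hc₂pos : 0 < c₂ := by positivity
        have hsq := hexp (c₂ * a) (-c₁)
        have hn := unitIntegral_mul_self_nonneg
          (C (c₂ * a) * derivative L + C (-c₁) * derivative w)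
        rw [hsq, hLL] at hn
        have hmul := mul_le_mul_of_nonneg_left hww (sq_nonneg c₁)
        refine le_of_mul_le_mul_left ?_ (mul_pos hc₁pos hc₂pos)
        rw [hα]
        linarith
    have hsum : ((p : ℝ) + 1) * (p + 1 + 1) ^ 2 * (p + 1 + 2) = c₁ + c₂ := by
      rw [hc₁, hc₂]; ring
    rw [e2, e1, hsum, hLL]
    have : a ^ 2 * (c₁ * unitIntegral (L * L)) = c₁ * α := by rw [hα]; ring
    rw [this]
    linarith

lemma integral_derivative_sq_le {p : ℕ} {q : ℝ[X]} (hq : q.natDegree ≤ p) {a b : ℝ}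
    (hab : a + 1 ≤ b) :
    ∫ x in a..b, (derivative q).eval x ^ 2 ≤ 12 * (p : ℝ) ^ 4 * ∫ x in a..b, q.eval x ^ 2 := by
  have hc : 0 < b - a := by linarith
  set w := q.comp (C (b - a) * X + C a) with hw
  have hwdeg : w.natDegree ≤ p := by
    refine natDegree_comp_le.trans ?_
    calc q.natDegree * (C (b - a) * X + C a).natDegree ≤ q.natDegree * 1 :=
          Nat.mul_le_mul_left _ natDegree_linear_le
      _ ≤ p := by omega
  have hscale : ∀ g : ℝ → ℝ,
      ∫ x in a..b, g x = (b - a) * ∫ x in (0 : ℝ)..1, g ((b - a) * x + a) := by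
    intro g
    have := intervalIntegral.mul_integral_comp_mul_add (a := 0) (b := 1) (f := g) (b - a) a
    rw [this]
    simp
  have h := unitIntegral_derivative_sq_le p w hwdeg
  have e1 : unitIntegral (derivative w * derivative w) =
      (b - a) ^ 2 * ∫ x in (0 : ℝ)..1, (derivative q).eval ((b - a) * x + a) ^ 2 := by
    rw [unitIntegral_apply, ← intervalIntegral.integral_const_mul]
    congr 1
    ext x
    simp [hw, derivative_comp]
    ring
  have e2 : unitIntegral (w * w) = ∫ x in (0 : ℝ)..1, q.eval ((b - a) * x + a) ^ 2 := by
    rw [unitIntegral_apply]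
    congr 1
    ext x
    simp [hw]
    ring
  rw [hscale, hscale (fun x => q.eval x ^ 2)]
  rw [e1, e2] at h
  set I := ∫ x in (0 : ℝ)..1, (derivative q).eval ((b - a) * x + a) ^ 2
  set J := ∫ x in (0 : ℝ)..1, q.eval ((b - a) * x + a) ^ 2
  have hI : 0 ≤ I := intervalIntegral.integral_nonneg zero_le_one fun x _ => sq_nonneg _
  have hJ : 0 ≤ J := intervalIntegral.integral_nonneg zero_le_one fun x _ => sq_nonneg _
  -- The only use of length at least 1: rescaling to `[0,1]` multiplies the squared derivative by
  -- `(b - a)²`.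
  have hIJ : I ≤ (b - a) ^ 2 * I := le_mul_of_one_le_left hI (by nlinarith)
  have hconst : (p : ℝ) * (p + 1) ^ 2 * (p + 2) ≤ 12 * (p : ℝ) ^ 4 := by
    rcases Nat.eq_zero_or_pos p with rfl | hp
    · simp
    · have hp1 : (1 : ℝ) ≤ p := by exact_mod_cast hp
      -- Since `p ≥ 1`, `p + 1 ≤ 2p` and `p + 2 ≤ 3p`, whence the factor `2² · 3 = 12`.
      calc (p : ℝ) * (p + 1) ^ 2 * (p + 2) ≤ p * (p + p) ^ 2 * (p + 2 * p) := by gcongr; linarith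
        _ = 12 * (p : ℝ) ^ 4 := by ring
  calc (b - a) * I ≤ (b - a) * (12 * (p : ℝ) ^ 4 * J) := by
        gcongr
        exact hIJ.trans (h.trans (by gcongr))
    _ = 12 * (p : ℝ) ^ 4 * ((b - a) * J) := by ring

end OneVariable

/-! ### From one variable to directional derivatives, by integration along parallel lines. -/

section Lines

open scoped ENNReal

variable {d : ℕ}

/-- Comparing integrals along all lines parallel to `e` compares the integrals over the space. -/
lemma lintegral_le_of_line_le {e : EuclideanSpace ℝ (Fin d)} (he : e ≠ 0)
    {F G : EuclideanSpace ℝ (Fin d) → ℝ≥0∞} (hF : Measurable F) (hG : Measurable G)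
    (h : ∀ x, ∫⁻ t : ℝ, F (x + t • e) ≤ ∫⁻ t : ℝ, G (x + t • e)) :
    ∫⁻ x, F x ≤ ∫⁻ x, G x := by
  let ℓ : EuclideanSpace ℝ (Fin d) → ℝ := fun x => inner ℝ e x / ‖e‖ ^ 2
  have hℓ : Measurable ℓ := by fun_prop
  have hℓe : ∀ x (t : ℝ), ℓ (x + t • e) = ℓ x + t := by
    intro x t
    have : ‖e‖ ^ 2 ≠ 0 := by positivity
    simp only [ℓ, inner_add_right, inner_smul_right, real_inner_self_eq_norm_sq]
    field_simp
  let k : ℝ → ℝ≥0∞ := (Set.Icc (0 : ℝ) 1).indicator 1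
  have hk : Measurable k := measurable_one.indicator measurableSet_Icc
  have hk1 : ∫⁻ t, k t = 1 := by
    simp only [k]
    rw [lintegral_indicator_one measurableSet_Icc]
    simp
  -- Insert `1 = ∫ k (ℓ x - t) dt`, exchange the integrals and translate by `t • e`. The weight `k ∘
  -- ℓ` has total mass 1 on each line, so no coordinates adapted to `e` are needed.
  have key : ∀ H : EuclideanSpace ℝ (Fin d) → ℝ≥0∞, Measurable H →
      ∫⁻ x, H x = ∫⁻ x, k (ℓ x) * ∫⁻ t : ℝ, H (x + t • e) := by
    intro H hH
    calc ∫⁻ x, H x = ∫⁻ x, ∫⁻ t : ℝ, H x * k (ℓ x - t) := by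
          refine lintegral_congr fun x => ?_
          rw [lintegral_const_mul _ (by fun_prop), lintegral_sub_left_eq_self k, hk1, mul_one]
      _ = ∫⁻ t : ℝ, ∫⁻ x, H x * k (ℓ x - t) :=
          lintegral_lintegral_swap (by fun_prop)
      _ = ∫⁻ t : ℝ, ∫⁻ x, H (x + t • e) * k (ℓ x) := by
          refine lintegral_congr fun t => ?_
          rw [← lintegral_add_right_eq_self _ (t • e)]
          simp only [hℓe, add_sub_cancel_right]
      _ = ∫⁻ x, ∫⁻ t : ℝ, H (x + t • e) * k (ℓ x) :=
          lintegral_lintegral_swap (by fun_prop)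
      _ = _ := by
          refine lintegral_congr fun x => ?_
          rw [lintegral_mul_const _ (by fun_prop), mul_comm]
  rw [key F hF, key G hG]
  exact lintegral_mono fun x => mul_le_mul_right (h x) _

lemma contDiff_polyFun (v : MvPolynomial (Fin d) ℝ) : ContDiff ℝ 1 (polyFun v) := by
  unfold polyFun
  induction v using MvPolynomial.induction_on with
  | C a => simpa using contDiff_const
  | add p q hp hq => simpa using hp.add hq
  | mul_X p i hp =>
    simp only [map_mul, MvPolynomial.eval_X]
    exact hp.mul (by fun_prop)

lemma exists_polynomial_on_line {p : ℕ} {v : MvPolynomial (Fin d) ℝ} (hv : v.totalDegree ≤ p)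
    (x e : EuclideanSpace ℝ (Fin d)) :
    ∃ q : Polynomial ℝ, q.natDegree ≤ p ∧ (∀ t : ℝ, q.eval t = polyFun v (x + t • e)) ∧
      ∀ t : ℝ, q.derivative.eval t = fderiv ℝ (polyFun v) (x + t • e) e := by
  set q : Polynomial ℝ :=
    MvPolynomial.aeval (fun i => Polynomial.C (e i) * Polynomial.X + Polynomial.C (x i)) v
  have hq : ∀ t : ℝ, q.eval t = polyFun v (x + t • e) := by
    intro t
    simp only [q, polyFun]
    clear hv
    induction v using MvPolynomial.induction_on with
    | C a => simp
    | add f g hf hg => simp only [map_add, Polynomial.eval_add, hf, hg]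
    | mul_X f i hf =>
      simp only [map_mul, Polynomial.eval_mul, hf]
      simp
      ring_nf
      simp
  refine ⟨q, ?_, hq, fun t => ?_⟩
  · have := MvPolynomial.aeval_natDegree_le (m := p) (n := 1) v hv _
      (fun i => Polynomial.natDegree_linear_le (a := e i) (b := x i))
    simpa using this
  · have h1 := q.hasDerivAt t
    have hline : HasDerivAt (fun t : ℝ => x + t • e) e t := by
      simpa using ((hasDerivAt_id t).smul_const e).const_add x
    have h2 := ((contDiff_polyFun v).differentiable one_ne_zero (x + t • e)).hasFDerivAt.comp_hasDerivAt
      t hline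
    have h3 : (polyFun v ∘ fun t : ℝ => x + t • e) = fun t => q.eval t := by
      ext s; exact (hq s).symm
    rw [h3] at h2
    exact h1.unique h2

/-- On each line parallel to `e` the polynomial is univariate of degree at most `p`, and the slice
of `A` is empty or a compact interval of parameter length at least 1. Lengths and derivatives are
both measured in the parameter of `e`, so `e` need not be a unit vector. -/
lemma lintegral_dirDeriv_sq_le {p : ℕ} {v : MvPolynomial (Fin d) ℝ} (hv : v.totalDegree ≤ p)
    {e : EuclideanSpace ℝ (Fin d)} (he : e ≠ 0) {A : Set (EuclideanSpace ℝ (Fin d))}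
    (hA : IsCompact A) (hconv : ∀ x, Set.OrdConnected {t : ℝ | x + t • e ∈ A})
    (hlen : ∀ x ∈ A, ∃ t : ℝ, x + t • e ∈ A ∧ x + (t + 1) • e ∈ A) :
    ∫⁻ x in A, ENNReal.ofReal (fderiv ℝ (polyFun v) x e ^ 2) ≤
      ENNReal.ofReal (12 * (p : ℝ) ^ 4) * ∫⁻ x in A, ENNReal.ofReal (polyFun v x ^ 2) := by
  have hcont := (contDiff_polyFun v).continuous
  have hcont' : Continuous fun x => fderiv ℝ (polyFun v) x e :=
    ((contDiff_polyFun v).continuous_fderiv one_ne_zero).clm_apply continuous_const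
  have hAm := hA.measurableSet
  rw [← lintegral_const_mul _ (by fun_prop), ← lintegral_indicator hAm, ← lintegral_indicator hAm]
  refine lintegral_le_of_line_le he (Measurable.indicator (by fun_prop) hAm)
    (Measurable.indicator (by fun_prop) hAm) fun x => ?_
  obtain ⟨q, hqdeg, hq, hq'⟩ := exists_polynomial_on_line hv x e
  set S := {t : ℝ | x + t • e ∈ A} with hS
  have hlinecont : Continuous fun t : ℝ => x + t • e := by fun_prop
  have hSclosed : IsClosed S := hA.isClosed.preimage hlinecont
  have hSm := hSclosed.measurableSet
  have hind : ∀ H : EuclideanSpace ℝ (Fin d) → ℝ≥0∞,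
      ∫⁻ t : ℝ, A.indicator H (x + t • e) = ∫⁻ t in S, H (x + t • e) := by
    intro H
    rw [← lintegral_indicator hSm]
    rfl
  rw [hind, hind]
  simp only [← hq, ← hq']
  rcases S.eq_empty_or_nonempty with hSe | ⟨s, hs⟩
  · simp [hSe]
  have hSbdd : Bornology.IsBounded S := by
    obtain ⟨R, hR⟩ := isBounded_iff_forall_norm_le.1 hA.isBounded
    refine isBounded_iff_forall_norm_le.2 ⟨(R + ‖x‖) / ‖e‖, fun t ht => ?_⟩
    rw [le_div_iff₀ (norm_pos_iff.2 he), ← norm_smul]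
    calc ‖t • e‖ = ‖(x + t • e) - x‖ := by rw [add_sub_cancel_left]
      _ ≤ ‖x + t • e‖ + ‖x‖ := norm_sub_le _ _
      _ ≤ R + ‖x‖ := by gcongr; exact hR _ ht
  have hScomp : IsCompact S := Metric.isCompact_of_isClosed_isBounded hSclosed hSbdd
  obtain ⟨t, ht0, ht1⟩ := hlen _ hs
  have ht0' : s + t ∈ S := by
    simpa only [hS, Set.mem_ofPred_eq, add_smul, add_assoc] using ht0
  have ht1' : s + t + 1 ∈ S := by
    simpa only [hS, Set.mem_ofPred_eq, add_smul, add_assoc] using ht1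
  have hSIcc : S = Set.Icc (sInf S) (sSup S) :=
    eq_Icc_of_connected_compact ⟨⟨s, hs⟩, (hconv x).isPreconnected⟩ hScomp
  set a := sInf S
  set b := sSup S
  have hab : a + 1 ≤ b := by
    rw [hSIcc] at ht0' ht1'
    linarith [ht0'.1, ht1'.2]
  have hkey := integral_derivative_sq_le hqdeg hab
  have hconv' : ∀ w : Polynomial ℝ, ∫⁻ t in S, ENNReal.ofReal (w.eval t ^ 2) =
      ENNReal.ofReal (∫ t in a..b, w.eval t ^ 2) := by
    intro w
    rw [hSIcc, intervalIntegral.integral_of_le (by linarith), ← integral_Icc_eq_integral_Ioc,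
      ofReal_integral_eq_lintegral_ofReal (f := fun t => w.eval t ^ 2)
        ((w.continuous.pow 2).continuousOn.integrableOn_compact isCompact_Icc)
        (Filter.Eventually.of_forall fun _ => sq_nonneg _)]
  rw [lintegral_const_mul _ (by fun_prop), hconv', hconv',
    ← ENNReal.ofReal_mul (by positivity)]
  exact ENNReal.ofReal_le_ofReal hkey

lemma setIntegral_dirDeriv_sq_le {p : ℕ} {v : MvPolynomial (Fin d) ℝ} (hv : v.totalDegree ≤ p)
    {e : EuclideanSpace ℝ (Fin d)} (he : e ≠ 0) {A : Set (EuclideanSpace ℝ (Fin d))}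
    (hA : IsCompact A) (hconv : ∀ x, Set.OrdConnected {t : ℝ | x + t • e ∈ A})
    (hlen : ∀ x ∈ A, ∃ t : ℝ, x + t • e ∈ A ∧ x + (t + 1) • e ∈ A) :
    ∫ x in A, fderiv ℝ (polyFun v) x e ^ 2 ≤ 12 * (p : ℝ) ^ 4 * ∫ x in A, polyFun v x ^ 2 := by
  have hcont := (contDiff_polyFun v).continuous
  have hcont' : Continuous fun x => fderiv ℝ (polyFun v) x e :=
    ((contDiff_polyFun v).continuous_fderiv one_ne_zero).clm_apply continuous_const
  have h := lintegral_dirDeriv_sq_le hv he hA hconv hlen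
  have hofReal : ∀ g : EuclideanSpace ℝ (Fin d) → ℝ, Continuous g →
      ∫⁻ x in A, ENNReal.ofReal (g x ^ 2) = ENNReal.ofReal (∫ x in A, g x ^ 2) := fun g hg =>
    (ofReal_integral_eq_lintegral_ofReal (f := fun x => g x ^ 2)
      ((hg.pow 2).continuousOn.integrableOn_compact hA)
      (Filter.Eventually.of_forall fun _ => sq_nonneg _)).symm
  rw [hofReal _ hcont, hofReal _ hcont', ← ENNReal.ofReal_mul (by positivity)] at h
  refine (ENNReal.ofReal_le_ofReal_iff (mul_nonneg (by positivity) ?_)).1 h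
  exact integral_nonneg fun _ => sq_nonneg _

end Lines

/-! ### Compactness of the prism and its slanted segments. -/

section Geometry

variable {n : ℕ}

/-- The point of `ℝ^(n+1)` above `y` at height `h`. -/
noncomputable def pointAt (y : EuclideanSpace ℝ (Fin n)) (h : ℝ) :
    EuclideanSpace ℝ (Fin (n + 1)) :=
  WithLp.toLp 2 (Fin.snoc (α := fun _ => ℝ) (fun i => y i) h)

@[simp] lemma baseCoords_apply (x : EuclideanSpace ℝ (Fin (n + 1))) (i : Fin n) :
    baseCoords x i = x i.castSucc := rfl

@[simp] lemma pointAt_castSucc (y : EuclideanSpace ℝ (Fin n)) (h : ℝ) (i : Fin n) :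
    pointAt y h i.castSucc = y i := by simp [pointAt]

@[simp] lemma pointAt_last (y : EuclideanSpace ℝ (Fin n)) (h : ℝ) :
    pointAt y h (Fin.last n) = h := by simp [pointAt]

@[simp] lemma baseCoords_pointAt (y : EuclideanSpace ℝ (Fin n)) (h : ℝ) :
    baseCoords (pointAt y h) = y := by
  ext i; simp

@[simp] lemma baseCoords_add (x y : EuclideanSpace ℝ (Fin (n + 1))) :
    baseCoords (x + y) = baseCoords x + baseCoords y := by
  ext i; simp

@[simp] lemma baseCoords_smul (t : ℝ) (x : EuclideanSpace ℝ (Fin (n + 1))) :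
    baseCoords (t • x) = t • baseCoords x := by
  ext i; simp

lemma pointAt_mem_unitCube {y : EuclideanSpace ℝ (Fin n)} (hy : y ∈ unitCube n) {h : ℝ}
    (h0 : 0 ≤ h) (h1 : h ≤ 1) : pointAt y h ∈ unitCube (n + 1) := by
  intro i
  refine Fin.lastCases ?_ (fun j => ?_) i
  · simpa using ⟨h0, h1⟩
  · simpa using hy j

lemma isClosed_unitCube (n : ℕ) : IsClosed (unitCube n) := by
  have : unitCube n =
      ⋂ i, (fun x : EuclideanSpace ℝ (Fin n) => x i) ⁻¹' Set.Icc (0 : ℝ) 1 := by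
    ext x; simp [unitCube]
  rw [this]
  exact isClosed_iInter fun i => isClosed_Icc.preimage (by fun_prop)

lemma isCompact_of_isClosed_of_coord_mem {A : Set (EuclideanSpace ℝ (Fin n))} (hA : IsClosed A)
    {R : ℝ} (h : ∀ x ∈ A, ∀ i, |x i| ≤ R) : IsCompact A := by
  refine Metric.isCompact_of_isClosed_isBounded hA
    (isBounded_iff_forall_norm_le.2 ⟨√(∑ _i : Fin n, R ^ 2), fun x hx => ?_⟩)
  rw [EuclideanSpace.norm_eq]
  refine Real.sqrt_le_sqrt (Finset.sum_le_sum fun i _ => ?_)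
  rw [Real.norm_eq_abs]
  exact pow_le_pow_left₀ (abs_nonneg _) (h x hx i) 2

lemma isCompact_unitCube (n : ℕ) : IsCompact (unitCube n) :=
  isCompact_of_isClosed_of_coord_mem (R := 1) (isClosed_unitCube n) fun x hx i =>
    abs_le.2 ⟨by linarith [(hx i).1], (hx i).2⟩

lemma continuous_baseCoords : Continuous (baseCoords (n := n)) := by
  unfold baseCoords
  fun_prop

variable {φ : EuclideanSpace ℝ (Fin n) → ℝ}

namespace IsReferenceGeneralizedPrism

lemma one_le (hφ : IsReferenceGeneralizedPrism φ) {y : EuclideanSpace ℝ (Fin n)}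
    (hy : y ∈ unitCube n) : 1 ≤ φ y := by
  simpa using (hφ.cube_subset (pointAt_mem_unitCube hy zero_le_one le_rfl)).2.2

lemma le_rHat (hφ : IsReferenceGeneralizedPrism φ) {y : EuclideanSpace ℝ (Fin n)}
    (hy : y ∈ unitCube n) : φ y ≤ rHat φ := by
  obtain ⟨L, hL⟩ := hφ.lipschitz
  have hbdd : BddAbove (φ '' unitCube n) :=
    ((isCompact_unitCube n).image_of_continuousOn hL.continuousOn).bddAbove
  have h1 : φ y ≤ sSup (φ '' unitCube n) := le_csSup hbdd ⟨y, hy, rfl⟩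
  have h2 := (Int.lt_floor_add_one (sSup (φ '' unitCube n))).le
  simp only [rHat, Int.cast_add, Int.cast_one]
  linarith

lemma one_le_rHat (hφ : IsReferenceGeneralizedPrism φ) : (1 : ℝ) ≤ rHat φ := by
  have h0 : (0 : EuclideanSpace ℝ (Fin n)) ∈ unitCube n := fun i => by simp
  exact (hφ.one_le h0).trans (hφ.le_rHat h0)

lemma isClosed_prism (hφ : IsReferenceGeneralizedPrism φ) : IsClosed (prism φ) := by
  obtain ⟨L, hL⟩ := hφ.lipschitz
  -- `φ` is controlled only on the cube, so a Lipschitz extension is needed to describe the prism by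
  -- closed conditions.
  obtain ⟨g, hg, hgφ⟩ := hL.extend_real
  have : prism φ = baseCoords ⁻¹' unitCube n ∩ ({x | 0 ≤ x (Fin.last n)} ∩
      {x | x (Fin.last n) ≤ g (baseCoords x)}) := by
    ext x
    constructor
    · rintro ⟨h1, h2, h3⟩
      exact ⟨h1, h2, h3.trans_eq (hgφ h1)⟩
    · rintro ⟨h1, h2, h3⟩
      exact ⟨h1, h2, le_of_le_of_eq h3 (hgφ h1).symm⟩
  rw [this]
  exact ((isClosed_unitCube n).preimage continuous_baseCoords).inter
    ((isClosed_le continuous_const (by fun_prop)).inter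
      (isClosed_le (by fun_prop) (hg.continuous.comp continuous_baseCoords)))

lemma isCompact_prism (hφ : IsReferenceGeneralizedPrism φ) : IsCompact (prism φ) := by
  refine isCompact_of_isClosed_of_coord_mem (R := rHat φ) hφ.isClosed_prism fun x hx i => ?_
  refine Fin.lastCases ?_ (fun j => ?_) i
  · rw [abs_of_nonneg hx.2.1]
    exact hx.2.2.trans (hφ.le_rHat hx.1)
  · have := hx.1 j
    rw [baseCoords_apply] at this
    rw [abs_of_nonneg this.1]
    exact this.2.trans hφ.one_le_rHat

/-- Moving down from a point of the prism in the direction `(w, -1)` stays in the prism, provided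
that the flat base is met. -/
lemma descend (hφ : IsReferenceGeneralizedPrism φ) {x : EuclideanSpace ℝ (Fin (n + 1))}
    (hx : x ∈ prism φ) {w : EuclideanSpace ℝ (Fin n)}
    (hw : baseCoords x + x (Fin.last n) • w ∈ unitCube n) {h : ℝ} (h0 : 0 ≤ h)
    (hle : h ≤ x (Fin.last n)) :
    pointAt (baseCoords x + (x (Fin.last n) - h) • w) h ∈ prism φ := by
  set y := x (Fin.last n) with hy
  rcases h0.eq_or_lt with rfl | hpos
  -- At height 0 the point is the foot itself; treating it apart avoids dividing by `y`, which may
  -- vanish.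
  · exact hφ.cube_subset (pointAt_mem_unitCube (by simpa using hw) le_rfl zero_le_one)
  have hypos : 0 < y := hpos.trans_le hle
  have ha : pointAt (baseCoords x + y • w) 0 ∈ flatBase n := ⟨by simpa using hw, by simp⟩
  have hb : pointAt (baseCoords x) (φ (baseCoords x)) ∈ curvedBase φ :=
    ⟨by simpa using hx.1, by simp⟩
  -- The segment runs from the foot to the graph point above `x`. At parameter `h / y` it lies over
  -- the required base point, at height `(h / y) φ ≥ h` because `φ ≥ y` there; so the graph over
  -- that base point is at height at least `h`.
  have hseg := hφ.starShaped _ ha _ hb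
    ⟨1 - h / y, h / y, sub_nonneg.2 ((div_le_one hypos).2 hle), by positivity, by ring, rfl⟩
  have hbase : (1 - h / y) • (baseCoords x + y • w) + (h / y) • baseCoords x =
      baseCoords x + (y - h) • w := by
    ext i
    simp
    field_simp
    ring
  obtain ⟨h1, -, h3⟩ := hseg
  simp only [baseCoords_add, baseCoords_smul, baseCoords_pointAt, hbase] at h1 h3
  refine ⟨by simpa using h1, by simpa using h0, ?_⟩
  simp only [pointAt_last, baseCoords_pointAt]
  refine le_trans ?_ h3
  simp only [PiLp.add_apply, PiLp.smul_apply, pointAt_last, smul_eq_mul, mul_zero, zero_add]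
  calc h = h / y * y := by field_simp
    _ ≤ h / y * φ (baseCoords x) := by gcongr; exact hx.2.2

end IsReferenceGeneralizedPrism

/-- The union of the segments parallel to `(-w, 1)` in the prism that rise from the flat base and
reach height `1` inside the unit cube. -/
def slantedPart (φ : EuclideanSpace ℝ (Fin n) → ℝ) (w : EuclideanSpace ℝ (Fin n)) :
    Set (EuclideanSpace ℝ (Fin (n + 1))) :=
  {x | x ∈ prism φ ∧ baseCoords x + x (Fin.last n) • w ∈ unitCube n ∧
    baseCoords x + (x (Fin.last n) - 1) • w ∈ unitCube n}

lemma slantedPart_zero : slantedPart φ (0 : EuclideanSpace ℝ (Fin n)) = prism φ := by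
  ext x
  refine ⟨fun h => h.1, fun h => ⟨h, ?_, ?_⟩⟩ <;> simpa using h.1

namespace IsReferenceGeneralizedPrism

lemma isCompact_slantedPart (hφ : IsReferenceGeneralizedPrism φ)
    (w : EuclideanSpace ℝ (Fin n)) : IsCompact (slantedPart φ w) := by
  have hb := continuous_baseCoords (n := n)
  refine hφ.isCompact_prism.inter_right (IsClosed.inter ?_ ?_)
  · exact (isClosed_unitCube n).preimage
      (f := fun x => baseCoords x + x (Fin.last n) • w) (by fun_prop)
  · exact (isClosed_unitCube n).preimage
      (f := fun x => baseCoords x + (x (Fin.last n) - 1) • w) (by fun_prop)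

lemma setIntegral_slanted_le (hφ : IsReferenceGeneralizedPrism φ) {p : ℕ}
    {v : MvPolynomial (Fin (n + 1)) ℝ} (hv : v.totalDegree ≤ p) (w : EuclideanSpace ℝ (Fin n)) :
    ∫ x in slantedPart φ w, fderiv ℝ (polyFun v) x (pointAt (-w) 1) ^ 2 ≤
      12 * (p : ℝ) ^ 4 * ∫ x in slantedPart φ w, polyFun v x ^ 2 := by
  have hlast : ∀ (x : EuclideanSpace ℝ (Fin (n + 1))) (t : ℝ),
      (x + t • pointAt (-w) 1) (Fin.last n) = x (Fin.last n) + t := by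
    intro x t; simp
  have hbase : ∀ (x : EuclideanSpace ℝ (Fin (n + 1))) (t : ℝ),
      baseCoords (x + t • pointAt (-w) 1) = baseCoords x - t • w := by
    intro x t
    simp [sub_eq_add_neg]
  -- The points at heights 0 and 1 are common to the whole slanted line, so along it only membership
  -- in the prism varies.
  have hfoot : ∀ (x : EuclideanSpace ℝ (Fin (n + 1))) (t c : ℝ),
      baseCoords (x + t • pointAt (-w) 1) +
        ((x + t • pointAt (-w) 1) (Fin.last n) - c) • w =
        baseCoords x + (x (Fin.last n) - c) • w := by
    intro x t c
    rw [hlast, hbase]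
    module
  have hmem : ∀ (x : EuclideanSpace ℝ (Fin (n + 1))) (t : ℝ),
      x + t • pointAt (-w) 1 ∈ slantedPart φ w ↔ x + t • pointAt (-w) 1 ∈ prism φ ∧
        baseCoords x + x (Fin.last n) • w ∈ unitCube n ∧
        baseCoords x + (x (Fin.last n) - 1) • w ∈ unitCube n := by
    intro x t
    have h0 := hfoot x t 0
    rw [sub_zero, sub_zero] at h0
    rw [slantedPart, Set.mem_ofPred_eq, hfoot, h0]
  have hpoint : ∀ (x : EuclideanSpace ℝ (Fin (n + 1))) (t : ℝ),
      x + t • pointAt (-w) 1 = pointAt (baseCoords x - t • w) (x (Fin.last n) + t) := by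
    intro x t
    ext i
    refine Fin.lastCases ?_ (fun j => ?_) i
    · simp
    · simp [sub_eq_add_neg]
  refine setIntegral_dirDeriv_sq_le hv ?_ (hφ.isCompact_slantedPart w) ?_ ?_
  · intro h
    have := congrArg (fun z : EuclideanSpace ℝ (Fin (n + 1)) => z (Fin.last n)) h
    simp at this
  -- Points between two parameters are reached by descending from the upper one; the lower one only
  -- guarantees a nonnegative height.
  · refine fun x => ⟨fun s hs t ht u hu => ?_⟩
    have hs' := (hmem x s).1 hs
    have ht' := (hmem x t).1 ht
    refine (hmem x u).2 ⟨?_, hs'.2⟩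
    have hs0 := hs'.1.2.1
    rw [hlast] at hs0
    have hft := hfoot x t 0
    rw [sub_zero, sub_zero] at hft
    have := hφ.descend ht'.1 (w := w) (h := x (Fin.last n) + u) (hft ▸ ht'.2.1)
      (by linarith [hu.1]) (by rw [hlast]; linarith [hu.2])
    rw [hpoint]
    convert! this using 2
    rw [hlast, hbase]
    module
  · intro x hx
    -- These two parameters give the points of the line at heights 0 and 1, both in the unit cube.
    refine ⟨-x (Fin.last n), (hmem x _).2 ⟨?_, hx.2⟩, (hmem x _).2 ⟨?_, hx.2⟩⟩ <;>
      rw [hpoint] <;> apply hφ.cube_subset <;> apply pointAt_mem_unitCube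
    · convert! hx.2.1 using 1
      module
    · simp
    · simp
    · convert! hx.2.2 using 1
      module
    · simp
    · simp

end IsReferenceGeneralizedPrism

end Geometry

/-! ### Covering the prism and bounding each partial derivative. -/

section InverseEstimate

variable {n : ℕ} {φ : EuclideanSpace ℝ (Fin n) → ℝ}

lemma setIntegral_union_le {d : ℕ} {g : EuclideanSpace ℝ (Fin d) → ℝ} (hg : Continuous g)
    (hg0 : ∀ x, 0 ≤ g x) {A B : Set (EuclideanSpace ℝ (Fin d))} (hA : IsCompact A)
    (hB : IsCompact B) : ∫ x in A ∪ B, g x ≤ (∫ x in A, g x) + ∫ x in B, g x := by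
  have hint : ∀ {S : Set (EuclideanSpace ℝ (Fin d))}, IsCompact S → IntegrableOn g S :=
    fun hS => hg.continuousOn.integrableOn_compact hS
  rw [← Set.union_sdiff_self, setIntegral_union Set.disjoint_sdiff_right
    (hB.measurableSet.diff hA.measurableSet) (hint hA) ((hint hB).mono_set Set.sdiff_subset)]
  refine add_le_add_right ?_ _
  exact setIntegral_mono_set (hint hB) (Filter.Eventually.of_forall hg0)
    Set.sdiff_subset.eventuallyLE

lemma setIntegral_mono_of_isCompact {d : ℕ} {g : EuclideanSpace ℝ (Fin d) → ℝ}
    (hg : Continuous g) (hg0 : ∀ x, 0 ≤ g x) {A B : Set (EuclideanSpace ℝ (Fin d))}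
    (hB : IsCompact B) (hAB : A ⊆ B) : ∫ x in A, g x ≤ ∫ x in B, g x :=
  setIntegral_mono_set (hg.continuousOn.integrableOn_compact hB)
    (Filter.Eventually.of_forall hg0) hAB.eventuallyLE

lemma setIntegral_unitCube_le {d p : ℕ} {v : MvPolynomial (Fin d) ℝ} (hv : v.totalDegree ≤ p)
    (j : Fin d) :
    ∫ x in unitCube d, fderiv ℝ (polyFun v) x (EuclideanSpace.single j 1) ^ 2 ≤
      12 * (p : ℝ) ^ 4 * ∫ x in unitCube d, polyFun v x ^ 2 := by
  refine setIntegral_dirDeriv_sq_le hv ?_ (isCompact_unitCube d) ?_ ?_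
  · intro h
    have := congrArg (fun z : EuclideanSpace ℝ (Fin d) => z j) h
    simp at this
  · refine fun x => ⟨fun s hs t ht u hu i => ?_⟩
    have hs' := hs i
    have ht' := ht i
    by_cases hij : i = j
    · subst hij
      simp at hs' ht' ⊢
      exact ⟨by linarith [hu.1], by linarith [hu.2]⟩
    · simpa [hij] using hs'
  · intro x hx
    refine ⟨-x j, fun i => ?_, fun i => ?_⟩ <;> by_cases hij : i = j
    · subst hij; simp
    · simpa [hij] using hx i
    · subst hij; simp
    · simpa [hij] using hx i

namespace IsReferenceGeneralizedPrism

lemma setIntegral_vertical_le (hφ : IsReferenceGeneralizedPrism φ) {p : ℕ}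
    {v : MvPolynomial (Fin (n + 1)) ℝ} (hv : v.totalDegree ≤ p) :
    ∫ x in prism φ, fderiv ℝ (polyFun v) x (EuclideanSpace.single (Fin.last n) 1) ^ 2 ≤
      12 * (p : ℝ) ^ 4 * ∫ x in prism φ, polyFun v x ^ 2 := by
  have h := hφ.setIntegral_slanted_le hv 0
  have e : pointAt (-(0 : EuclideanSpace ℝ (Fin n))) 1 =
      EuclideanSpace.single (Fin.last n) 1 := by
    ext i
    refine Fin.lastCases ?_ (fun j => ?_) i
    · simp
    · simp [Fin.castSucc_ne_last]
  rwa [slantedPart_zero, e] at h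

/-- A point of height at most 1 is in the cube. Otherwise its height `y` satisfies `1 < y ≤ r̂`, so
the shifts `y s` and `(y - 1) s` lie in `[0, 1/2]`; moving the `i`-th coordinate by them towards the
farther of 0 and 1 keeps it in `[0,1]`. The bound 1/2 dictates `s = 1/(2 r̂)`. -/
lemma prism_subset_union (hφ : IsReferenceGeneralizedPrism φ) (i : Fin n) :
    prism φ ⊆ (unitCube (n + 1) ∪
      slantedPart φ (EuclideanSpace.single i (1 / (2 * (rHat φ : ℝ))))) ∪
      slantedPart φ (EuclideanSpace.single i (-(1 / (2 * (rHat φ : ℝ))))) := by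
  intro x hx
  have hr := hφ.one_le_rHat
  have hyr : x (Fin.last n) ≤ rHat φ := hx.2.2.trans (hφ.le_rHat hx.1)
  set r : ℝ := (rHat φ : ℝ)
  set s := 1 / (2 * r) with hs
  have hspos : 0 < s := by positivity
  by_cases hy : x (Fin.last n) ≤ 1
  · refine Or.inl (Or.inl fun j => ?_)
    refine Fin.lastCases ⟨hx.2.1, hy⟩ (fun k => hx.1 k) j
  push Not at hy
  have hys : x (Fin.last n) * s ≤ 1 / 2 := by
    calc x (Fin.last n) * s ≤ r * s := by gcongr
      _ = 1 / 2 := by rw [hs]; field_simp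
  have hys0 : 0 ≤ (x (Fin.last n) - 1) * s := mul_nonneg (by linarith) hspos.le
  have hxi := hx.1 i
  rw [baseCoords_apply] at hxi
  have hshift : ∀ a b : ℝ, 0 ≤ x i.castSucc + a * b → x i.castSucc + a * b ≤ 1 →
      baseCoords x + a • EuclideanSpace.single i b ∈ unitCube n := by
    intro a b h0 h1 j
    by_cases hj : j = i
    · subst hj; simpa using ⟨h0, h1⟩
    · simpa [hj] using hx.1 j
  rcases le_total (x i.castSucc) (1 / 2) with h | h
  · refine Or.inl (Or.inr ⟨hx, hshift _ _ ?_ ?_, hshift _ _ ?_ ?_⟩) <;> linarith [hxi.1]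
  · refine Or.inr ⟨hx, hshift _ _ ?_ ?_, hshift _ _ ?_ ?_⟩ <;> linarith [hxi.2]

/-- Since `s ∂_i v = ∂_d v - ∂_e v` with `e = e_d - s e_i`, the square of `∂_i v` is at most `2 /
s²` times the sum of the squares of two derivatives that are already bounded. -/
lemma setIntegral_slantedPart_le (hφ : IsReferenceGeneralizedPrism φ) {p : ℕ}
    {v : MvPolynomial (Fin (n + 1)) ℝ} (hv : v.totalDegree ≤ p) (i : Fin n) {s : ℝ}
    (hs : s ≠ 0) :
    ∫ x in slantedPart φ (EuclideanSpace.single i s),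
        fderiv ℝ (polyFun v) x (EuclideanSpace.single i.castSucc 1) ^ 2 ≤
      4 / s ^ 2 * (12 * (p : ℝ) ^ 4 * ∫ x in prism φ, polyFun v x ^ 2) := by
  have hcont := (contDiff_polyFun v).continuous
  have hcont' : ∀ e, Continuous fun x => fderiv ℝ (polyFun v) x e := fun e =>
    ((contDiff_polyFun v).continuous_fderiv one_ne_zero).clm_apply continuous_const
  set A := slantedPart φ (EuclideanSpace.single i s)
  have hA : IsCompact A := hφ.isCompact_slantedPart _
  have hAK : A ⊆ prism φ := fun x hx => hx.1
  set e := pointAt (-(EuclideanSpace.single i s)) 1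
  set ed : EuclideanSpace ℝ (Fin (n + 1)) := EuclideanSpace.single (Fin.last n) 1
  set ei : EuclideanSpace ℝ (Fin (n + 1)) := EuclideanSpace.single i.castSucc 1
  have he : e = ed - s • ei := by
    ext j
    refine Fin.lastCases ?_ (fun k => ?_) j
    · simp [e, ed, ei, (Fin.castSucc_ne_last i).symm]
    · simp [e, ed, ei, Fin.castSucc_ne_last]
  have hint : ∀ u, IntegrableOn (fun x => fderiv ℝ (polyFun v) x u ^ 2) A := fun u =>
    ((hcont' u).pow 2).continuousOn.integrableOn_compact hA
  have hpt : ∀ x, fderiv ℝ (polyFun v) x ei ^ 2 ≤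
      2 / s ^ 2 * (fderiv ℝ (polyFun v) x ed ^ 2 + fderiv ℝ (polyFun v) x e ^ 2) := by
    intro x
    rw [he, map_sub, map_smul, smul_eq_mul]
    set α := fderiv ℝ (polyFun v) x ed
    set β := fderiv ℝ (polyFun v) x ei
    have hs2 : 0 < s ^ 2 := by positivity
    rw [div_mul_eq_mul_div, le_div_iff₀ hs2]
    nlinarith [sq_nonneg (2 * α - s * β)]
  have h1 : ∫ x in A, fderiv ℝ (polyFun v) x ed ^ 2 ≤
      12 * (p : ℝ) ^ 4 * ∫ x in prism φ, polyFun v x ^ 2 :=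
    (setIntegral_mono_of_isCompact ((hcont' ed).pow 2) (fun _ => sq_nonneg _)
      hφ.isCompact_prism hAK).trans (hφ.setIntegral_vertical_le hv)
  have h2 : ∫ x in A, fderiv ℝ (polyFun v) x e ^ 2 ≤
      12 * (p : ℝ) ^ 4 * ∫ x in prism φ, polyFun v x ^ 2 := by
    refine (hφ.setIntegral_slanted_le hv _).trans ?_
    refine mul_le_mul_of_nonneg_left ?_ (by positivity)
    exact setIntegral_mono_of_isCompact (hcont.pow 2) (fun _ => sq_nonneg _)
      hφ.isCompact_prism hAK
  calc ∫ x in A, fderiv ℝ (polyFun v) x ei ^ 2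
      ≤ ∫ x in A, 2 / s ^ 2 *
          (fderiv ℝ (polyFun v) x ed ^ 2 + fderiv ℝ (polyFun v) x e ^ 2) :=
        setIntegral_mono (hint ei) ((continuous_const.mul
          (((hcont' ed).pow 2).add ((hcont' e).pow 2))).continuousOn.integrableOn_compact hA) hpt
    _ = 2 / s ^ 2 * ((∫ x in A, fderiv ℝ (polyFun v) x ed ^ 2) +
          ∫ x in A, fderiv ℝ (polyFun v) x e ^ 2) := by
        rw [integral_const_mul, integral_add (hint ed) (hint e)]
    _ ≤ 2 / s ^ 2 * (12 * (p : ℝ) ^ 4 * (∫ x in prism φ, polyFun v x ^ 2) +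
          12 * (p : ℝ) ^ 4 * ∫ x in prism φ, polyFun v x ^ 2) := by gcongr
    _ = _ := by ring

lemma setIntegral_horizontal_le (hφ : IsReferenceGeneralizedPrism φ) {p : ℕ}
    {v : MvPolynomial (Fin (n + 1)) ℝ} (hv : v.totalDegree ≤ p) (i : Fin n) :
    ∫ x in prism φ, fderiv ℝ (polyFun v) x (EuclideanSpace.single i.castSucc 1) ^ 2 ≤
      (1 + 32 * (rHat φ : ℝ) ^ 2) *
        (12 * (p : ℝ) ^ 4 * ∫ x in prism φ, polyFun v x ^ 2) := by
  have hr := hφ.one_le_rHat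
  have hcover := hφ.prism_subset_union i
  set r : ℝ := (rHat φ : ℝ)
  have hcont := (contDiff_polyFun v).continuous
  have hg : Continuous fun x =>
      fderiv ℝ (polyFun v) x (EuclideanSpace.single i.castSucc 1) ^ 2 :=
    (((contDiff_polyFun v).continuous_fderiv one_ne_zero).clm_apply continuous_const).pow 2
  have hs : 1 / (2 * r) ≠ 0 := by positivity
  have hQ := isCompact_unitCube (n + 1)
  have hA := hφ.isCompact_slantedPart (EuclideanSpace.single i (1 / (2 * r)))
  have hB := hφ.isCompact_slantedPart (EuclideanSpace.single i (-(1 / (2 * r))))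
  have h0 := setIntegral_mono_of_isCompact hg (fun _ => sq_nonneg _)
    ((hQ.union hA).union hB) hcover
  have h1 := setIntegral_union_le hg (fun _ => sq_nonneg _) (hQ.union hA) hB
  have h2 := setIntegral_union_le hg (fun _ => sq_nonneg _) hQ hA
  have h3 : ∫ x in unitCube (n + 1),
      fderiv ℝ (polyFun v) x (EuclideanSpace.single i.castSucc 1) ^ 2 ≤
      12 * (p : ℝ) ^ 4 * ∫ x in prism φ, polyFun v x ^ 2 := by
    refine (setIntegral_unitCube_le hv _).trans ?_
    refine mul_le_mul_of_nonneg_left ?_ (by positivity)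
    exact setIntegral_mono_of_isCompact (hcont.pow 2) (fun _ => sq_nonneg _)
      hφ.isCompact_prism hφ.cube_subset
  have h4 := hφ.setIntegral_slantedPart_le hv i hs
  have h5 := hφ.setIntegral_slantedPart_le hv i (neg_ne_zero.2 hs)
  -- Each slanted part contributes `16 r²` and the cube contributes 1, giving `1 + 32 r²`.
  have hc : 4 / (1 / (2 * r)) ^ 2 = 16 * r ^ 2 := by
    field_simp
    ring
  rw [neg_sq, hc] at h5
  rw [hc] at h4
  linarith

end IsReferenceGeneralizedPrism

lemma norm_gradient_sq {d : ℕ} (f : EuclideanSpace ℝ (Fin d) → ℝ)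
    (x : EuclideanSpace ℝ (Fin d)) :
    ‖gradient f x‖ ^ 2 = ∑ j, fderiv ℝ f x (EuclideanSpace.single j 1) ^ 2 := by
  rw [EuclideanSpace.real_norm_sq_eq]
  refine Finset.sum_congr rfl fun j _ => ?_
  congr 1
  have : inner ℝ (gradient f x) (EuclideanSpace.single j 1) =
      fderiv ℝ f x (EuclideanSpace.single j 1) :=
    InnerProductSpace.toDual_symm_apply
  rw [← this, EuclideanSpace.inner_single_right]
  simp

end InverseEstimate

end GenPrism

/-- Inverse estimate on a reference generalized prism in `ℝ^d`, with `d = n + 1 ≥ 1`; the two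
integrability claims say that the `L²` norms involved are finite. -/
theorem mainTheorem5 (n p : ℕ) (φ : EuclideanSpace ℝ (Fin n) → ℝ)
    (hφ : GenPrism.IsReferenceGeneralizedPrism φ)
    (v : MvPolynomial (Fin (n + 1)) ℝ) (hv : v.totalDegree ≤ p) :
    IntegrableOn (fun x => ‖gradient (GenPrism.polyFun v) x‖ ^ 2) (GenPrism.prism φ) volume ∧
    IntegrableOn (fun x => (GenPrism.polyFun v x) ^ 2) (GenPrism.prism φ) volume ∧
    ∫ x in GenPrism.prism φ, ‖gradient (GenPrism.polyFun v) x‖ ^ 2 ≤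
      GenPrism.invConst (n + 1) (GenPrism.rHat φ : ℝ) * (p : ℝ) ^ 4 *
        ∫ x in GenPrism.prism φ, (GenPrism.polyFun v x) ^ 2 := by
  have hK := hφ.isCompact_prism
  have hcont := (GenPrism.contDiff_polyFun v).continuous
  have hint : ∀ e, IntegrableOn (fun x => fderiv ℝ (GenPrism.polyFun v) x e ^ 2)
      (GenPrism.prism φ) := fun e =>
    ((((GenPrism.contDiff_polyFun v).continuous_fderiv one_ne_zero).clm_apply
      continuous_const).pow 2).continuousOn.integrableOn_compact hK
  simp only [GenPrism.norm_gradient_sq]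
  refine ⟨integrable_finsetSum _ fun j _ => hint _,
    (hcont.pow 2).continuousOn.integrableOn_compact hK, ?_⟩
  rw [integral_finsetSum _ fun j _ => hint _, Fin.sum_univ_castSucc]
  have hvert := hφ.setIntegral_vertical_le hv
  have hhor := Finset.sum_le_sum fun i (_ : i ∈ Finset.univ) => hφ.setIntegral_horizontal_le hv i
  rw [Finset.sum_const, Finset.card_univ, Fintype.card_fin, nsmul_eq_mul] at hhor
  have hr := hφ.one_le_rHat
  set r : ℝ := (GenPrism.rHat φ : ℝ)
  set N := ∫ x in GenPrism.prism φ, GenPrism.polyFun v x ^ 2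
  have hN : 0 ≤ N := integral_nonneg fun _ => sq_nonneg _
  have hconst : (n : ℝ) * (1 + 32 * r ^ 2) * 12 + 12 ≤ GenPrism.invConst (n + 1) r := by
    -- After division by `64 r` this is `(2r - 1)(r - 1) ≥ 0`, which holds since `r ≥ 1`.
    have h1 : 384 * r ^ 2 ≤ 64 * r * (r + 1) * (2 * r + 1) := by
      nlinarith [mul_nonneg (by linarith : (0 : ℝ) ≤ r)
        (mul_nonneg (by linarith : (0 : ℝ) ≤ 2 * r - 1) (by linarith : (0 : ℝ) ≤ r - 1))]
    have h2 := mul_le_mul_of_nonneg_left h1 (Nat.cast_nonneg n)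
    simp only [GenPrism.invConst]
    push_cast
    linarith
  have hfinal := mul_le_mul_of_nonneg_right hconst (by positivity : 0 ≤ (p : ℝ) ^ 4 * N)
  linarith
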